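/- Let $m,n,p\ge 1$ be integers, and let $K_{m,n,p}$ be the labeled complete tripartite graph whose vertex set is the disjoint union of three sets $H_m,H_n,H_p$ of sizes $m,n,p$, two vertices being adjacent if and only if they lie in different sets. A rooted spanning tree of $K_{m,n,p}$ is a pair $(T,z)$ of a spanning tree $T$ of $K_{m,n,p}$ and a vertex $z$ of it, the root. The number of labeled rooted spanning trees of $K_{m,n,p}$ whose root lies in $H_p$ is $$p\,(m+n)^{p-1}(m+p)^{n-1}(n+p)^{m-1}(m+n+p).$$ -/

import Mathlib

/-- The vertex set of the labeled complete tripartite graph with parts of sizes `m`, `n`, `p`: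
the disjoint union of three labeled sets, indexed by `0`, `1`, `2`. -/
abbrev TripartiteVertex (m n p : ℕ) : Type :=
  Σ i : Fin 3, Fin (![m, n, p] i)

/-- The complete tripartite graph `K_{m,n,p}`: two vertices are adjacent exactly when they lie
in different parts. -/
abbrev completeTripartiteGraph (m n p : ℕ) : SimpleGraph (TripartiteVertex m n p) :=
  SimpleGraph.completeMultipartiteGraph fun i : Fin 3 => Fin (![m, n, p] i)

/-- The third part `H_p` of the vertex set of `K_{m,n,p}`. -/
def thirdPart (m n p : ℕ) : Set (TripartiteVertex m n p) :=
  {v | v.1 = 2}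

/-- A labeled rooted spanning tree of `G`: a subgraph of `G` on all the vertices of `G` which is
a tree, together with a distinguished vertex, its root. Two of them are equal exactly when they
have the same edges and the same root. -/
@[ext]
structure RootedSpanningTree {V : Type*} (G : SimpleGraph V) where
  /-- the underlying spanning tree -/
  tree : SimpleGraph V
  /-- every edge of the tree is an edge of `G` -/
  le : tree ≤ G
  /-- the tree is connected and acyclic -/
  isTree : tree.IsTree
  /-- the root -/
  root : V

/-- A finite graph has finitely many rooted spanning trees. -/
instance RootedSpanningTree.instFinite {V : Type*} [Finite V] (G : SimpleGraph V) :
    Finite (RootedSpanningTree G) :=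
  Finite.of_injective (fun R : RootedSpanningTree G => (R.tree, R.root)) fun _ _ h =>
    RootedSpanningTree.ext (congrArg Prod.fst h) (congrArg Prod.snd h)

/-! Orienting a spanning tree towards its root `z` identifies it with a parent map, so it suffices
to count parent maps for each `z`. Replace the row of `z` in the Laplacian by a unit row and expand
the determinant multilinearly in its rows: each choice of a neighbour for every other vertex gives
one term, equal to 1 if all iterates reach `z` and to 0 otherwise (`det_rootedLaplacian`). For the
tripartite graph this matrix is diagonal minus a product through `Fin 3`, so det(1 - AB) = det(1 -
BA) leaves a 3 × 3 determinant. Its value is the same for every `z` in the third part, whence the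
factor `p`. -/

/-- The self-maps of the vertex set that send every vertex other than `z` to one of its neighbours
and whose iterates send every vertex to the fixed point `z`. -/
structure IsParentMap {V : Type*} (G : SimpleGraph V) (z : V) (f : V → V) : Prop where
  map_root : f z = z
  adj : ∀ v, v ≠ z → G.Adj v (f v)
  reaches : ∀ v, ∃ k, f^[k] v = z

/-! ### Parent maps and spanning trees -/

namespace IsParentMap

variable {V : Type*} {G : SimpleGraph V} {z : V} {f g : V → V}

/-- A set of vertices that is closed under `f` and avoids `z` is empty. -/
theorem induction_escape (hr : ∀ v, ∃ k, f^[k] v = z) {P : V → Prop}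
    (hP : ∀ v, P v → P (f v)) (hz : ¬ P z) (v : V) : ¬ P v := by
  obtain ⟨k, hk⟩ := hr v
  intro hv
  have : ∀ k, P (f^[k] v) := fun k => by
    induction k with
    | zero => exact hv
    | succ k ih => rw [Function.iterate_succ_apply']; exact hP _ ih
  exact hz (hk ▸ this k)

/-- The graph whose edges join every vertex to its image. -/
def graph (f : V → V) : SimpleGraph V :=
  SimpleGraph.fromRel fun u v => f u = v

theorem graph_adj {u v : V} : (graph f).Adj u v ↔ u ≠ v ∧ (f u = v ∨ f v = u) := by
  simp [graph]

theorem graph_le (hf : IsParentMap G z f) : graph f ≤ G := by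
  intro u v huv
  obtain ⟨hne, h | h⟩ := graph_adj.1 huv
  · have : u ≠ z := by rintro rfl; exact hne (hf.map_root.symm.trans h)
    exact h ▸ hf.adj u this
  · have : v ≠ z := by rintro rfl; exact hne (h.symm.trans hf.map_root)
    exact (h ▸ hf.adj v this).symm

theorem graph_reachable_image (v : V) : (graph f).Reachable v (f v) := by
  by_cases h : v = f v
  · rw [← h]
  · exact (graph_adj.2 ⟨h, Or.inl rfl⟩).reachable

theorem graph_connected (hr : ∀ v, ∃ k, f^[k] v = z) : (graph f).Connected := by
  have h : ∀ v, (graph f).Reachable v z := fun v => by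
    by_contra hv
    refine induction_escape hr (P := fun v => ¬ (graph f).Reachable v z) ?_ ?_ v hv
    · exact fun v hv h => hv ((graph_reachable_image v).trans h)
    · simp
  have : Nonempty V := ⟨z⟩
  exact ⟨fun u v => (h u).trans (h v).symm⟩

/-- Every edge is `s(v, f v)` with `v ≠ z`, so a connected graph has at most |V| - 1 edges here. -/
theorem graph_isTree [Finite V] (hf : IsParentMap G z f) : (graph f).IsTree := by
  classical
  have := Fintype.ofFinite V
  have hc := graph_connected hf.reaches
  refine SimpleGraph.isTree_iff_connected_and_card.2 ⟨hc, le_antisymm ?_ ?_⟩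
  · have hsub : (graph f).edgeSet ⊆
        ((Finset.univ.erase z).image fun v => s(v, f v) : Finset (Sym2 V)) := by
      intro e
      induction e with
      | _ u v =>
        intro huv
        obtain ⟨hne, h | h⟩ := graph_adj.1 huv
        · have : u ≠ z := by rintro rfl; exact hne (hf.map_root.symm.trans h)
          simp only [Finset.coe_image, Set.mem_image]
          exact ⟨u, by simpa using this, by rw [h]⟩
        · have : v ≠ z := by rintro rfl; exact hne (h.symm.trans hf.map_root)
          simp only [Finset.coe_image, Set.mem_image]
          exact ⟨v, by simpa using this, by rw [h, Sym2.eq_swap]⟩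
    have h1 := Set.ncard_le_ncard hsub (Finset.finite_toSet _)
    rw [Set.ncard_coe_finset] at h1
    have h2 := h1.trans Finset.card_image_le
    rw [Finset.card_erase_of_mem (Finset.mem_univ z), Finset.card_univ,
      ← Nat.card_eq_fintype_card] at h2
    have h3 : 0 < Nat.card V := Nat.card_pos_iff.2 ⟨⟨z⟩, inferInstance⟩
    rw [Nat.card_coe_set_eq]
    omega
  · exact hc.card_vert_le_card_edgeSet_add_one

/-- If `f` and `g` differ at `v ≠ z`, the edge from `v` to `f v` can only come from `g (f v) = v`.
Then they differ at `f v` too, since otherwise `v` and `f v` form a 2-cycle of `f` that misses `z`.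
Disagreement thus propagates along `f` without ever meeting `z`. -/
theorem eq_of_graph_eq (hf : IsParentMap G z f) (hg : IsParentMap G z g)
    (h : graph f = graph g) : f = g := by
  have key : ∀ v, ¬ (v ≠ z ∧ f v ≠ g v) := by
    refine induction_escape hf.reaches ?_ (by simp)
    rintro v ⟨hv, hne⟩
    have hadj : (graph f).Adj v (f v) := graph_adj.2 ⟨(hf.adj v hv).ne, Or.inl rfl⟩
    rw [h, graph_adj] at hadj
    have hgf : g (f v) = v := hadj.2.resolve_left (Ne.symm hne)
    refine ⟨fun hz => hv ?_, fun heq => ?_⟩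
    · rw [← hgf, hz, hg.map_root]
    · have hffv : f (f v) = v := heq.trans hgf
      refine induction_escape hf.reaches (P := fun w => w = v ∨ w = f v) ?_ ?_ v (Or.inl rfl)
      · rintro w (rfl | rfl)
        · exact Or.inr rfl
        · exact Or.inl hffv
      · rintro (h' | h')
        · exact hv h'.symm
        · exact hv (by rw [← hffv, ← h', hf.map_root])
  funext v
  by_cases hv : v = z
  · rw [hv, hf.map_root, hg.map_root]
  · by_contra hne
    exact key v ⟨hv, hne⟩

/-- Every spanning tree arises from a parent map. -/
theorem exists_graph_eq {T : SimpleGraph V} (hT : T.IsTree) (hle : T ≤ G) (z : V) :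
    ∃ f, IsParentMap G z f ∧ graph f = T := by
  classical
  -- The parent is the next vertex on a geodesic to `z`.
  have hnext : ∀ v, ∃ w, (v = z → w = z) ∧ (v ≠ z → T.Adj v w ∧ T.dist w z < T.dist v z) := by
    intro v
    by_cases hv : v = z
    · exact ⟨z, fun _ => rfl, fun h => absurd hv h⟩
    · obtain ⟨p, hp⟩ := hT.connected.exists_walk_length_eq_dist v z
      cases p with
      | nil => exact absurd rfl hv
      | cons hadj q =>
        refine ⟨_, fun h => absurd h hv, fun _ => ⟨hadj, ?_⟩⟩
        rw [← hp, SimpleGraph.Walk.length_cons]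
        exact Nat.lt_succ_of_le (SimpleGraph.dist_le q)
  choose f hfz hf using hnext
  have hr : ∀ v, ∃ k, f^[k] v = z := by
    intro v
    induction hd : T.dist v z using Nat.strong_induction_on generalizing v with
    | _ d ih =>
      by_cases hv : v = z
      · exact ⟨0, hv⟩
      · obtain ⟨k, hk⟩ := ih _ (hd ▸ (hf v hv).2) (f v) rfl
        exact ⟨k + 1, hk⟩
  have hpT : IsParentMap T z f := ⟨hfz z rfl, fun v hv => (hf v hv).1, hr⟩
  refine ⟨f, ⟨hfz z rfl, fun v hv => hle (hf v hv).1, hr⟩, le_antisymm hpT.graph_le ?_⟩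
  -- A tree is minimal among connected graphs, so a connected subgraph on all vertices is the whole
  -- tree.
  exact (SimpleGraph.isTree_iff_minimal_connected.1 hT).2 (graph_connected hr) hpT.graph_le

end IsParentMap

/-- Spanning trees rooted at `z` correspond to parent maps. -/
theorem card_rootedSpanningTree_eq_card_isParentMap {V : Type*} [Finite V] (G : SimpleGraph V)
    (z : V) :
    Nat.card {R : RootedSpanningTree G // R.root = z} = Nat.card {f // IsParentMap G z f} := by
  symm
  refine Nat.card_congr (Equiv.ofBijective
    (fun f => ⟨⟨IsParentMap.graph f.1, f.2.graph_le, f.2.graph_isTree, z⟩, rfl⟩) ⟨?_, ?_⟩)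
  · intro f g h
    exact Subtype.ext (f.2.eq_of_graph_eq g.2
      (congrArg (fun R : {R : RootedSpanningTree G // R.root = z} => R.1.tree) h))
  · rintro ⟨⟨T, hle, hT, r⟩, rfl⟩
    obtain ⟨f, hf, hfT⟩ := IsParentMap.exists_graph_eq hT hle r
    exact ⟨⟨f, hf⟩, Subtype.ext (RootedSpanningTree.ext hfT rfl)⟩

/-! ### The matrix-tree theorem -/

section MatrixTree

open Matrix

variable {V : Type*} [Fintype V] [DecidableEq V]

/-- The row indexed by `v` of the matrix of a self-map with value `w` at `v`, rooted at `z`. -/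
def parentRow (z v w : V) : V → ℚ :=
  if v = z then Pi.single v 1 else Pi.single v 1 - Pi.single w 1

/-- If all iterates lead to `z`, the matrix is unitriangular for the depth. -/
theorem det_parentRow_of_reaches {z : V} {f : V → V} (hr : ∀ v, ∃ k, f^[k] v = z) :
    (Matrix.of fun v => parentRow z v (f v)).det = 1 := by
  set d : V → ℕ := fun v => Nat.find (hr v) with hd
  have hlt : ∀ v, v ≠ z → d (f v) < d v := by
    intro v hv
    have h1 := Nat.find_spec (hr v)
    rcases hk : Nat.find (hr v) with _ | k
    · rw [hk] at h1
      exact absurd h1 hv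
    · rw [hk] at h1
      have : d v = k + 1 := hk
      rw [this]
      exact Nat.lt_succ_of_le (Nat.find_min' (hr (f v)) h1)
  -- The only nonzero off-diagonal entry of row `i` is in column `f i`, of smaller depth.
  have hentry : ∀ i j, d i ≤ d j → (Matrix.of fun v => parentRow z v (f v)) i j =
      (1 : Matrix V V ℚ) i j := by
    intro i j hij
    by_cases hi : i = z
    · simp [parentRow, hi, Matrix.one_apply, Pi.single_apply, eq_comm]
    · have : j ≠ f i := by
        rintro rfl
        exact absurd (hlt i hi) (not_lt.2 hij)
      rw [Matrix.of_apply, parentRow, if_neg hi, Pi.sub_apply, Pi.single_eq_of_ne this, sub_zero,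
        Matrix.one_apply, Pi.single_apply]
      simp only [eq_comm]
  have hbt : (Matrix.of fun v => parentRow z v (f v)).BlockTriangular
      (fun v => OrderDual.toDual (d v)) := by
    intro i j hij
    have hij' : d i < d j := hij
    rw [hentry i j hij'.le, Matrix.one_apply_ne]
    rintro rfl
    exact lt_irrefl _ hij'
  rw [hbt.det]
  refine Finset.prod_eq_one fun k _ => ?_
  suffices h : (Matrix.of fun v => parentRow z v (f v)).toSquareBlock
      (fun v => OrderDual.toDual (d v)) k = 1 by rw [h, Matrix.det_one]
  ext ⟨i, hi⟩ ⟨j, hj⟩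
  have hij : d i = d j := OrderDual.toDual.injective (hi.trans hj.symm)
  rw [Matrix.toSquareBlock_def, Matrix.of_apply, hentry i j hij.le]
  simp [Matrix.one_apply]

/-- If some vertex never reaches `z`, the indicator of such vertices is a kernel vector. -/
theorem det_parentRow_of_not_reaches {z : V} {f : V → V} (hz : f z = z)
    (hr : ¬ ∀ v, ∃ k, f^[k] v = z) :
    (Matrix.of fun v => parentRow z v (f v)).det = 0 := by
  classical
  push Not at hr
  obtain ⟨u, hu⟩ := hr
  refine Matrix.exists_mulVec_eq_zero_iff.1
    ⟨fun v => if ∃ k, f^[k] v = z then 0 else 1, fun h => ?_, ?_⟩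
  · have := congrFun h u
    rw [if_neg (by simpa using hu)] at this
    simp at this
  · have hiff : ∀ v, (∃ k, f^[k] (f v) = z) ↔ ∃ k, f^[k] v = z := by
      refine fun v => ⟨fun ⟨k, hk⟩ => ⟨k + 1, hk⟩, fun ⟨k, hk⟩ => ⟨k, ?_⟩⟩
      rw [← Function.iterate_succ_apply, Function.iterate_succ_apply', hk, hz]
    funext v
    rw [Matrix.mulVec]
    by_cases hv : v = z
    · subst hv
      have : ∃ k, f^[k] v = v := ⟨0, rfl⟩
      simp [parentRow, this]
    · change parentRow z v (f v) ⬝ᵥ _ = 0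
      rw [parentRow, if_neg hv, sub_dotProduct]
      simp [hiff]

/-- The Laplacian matrix of `G` with the row of `z` replaced by a unit row. -/
def rootedLaplacian (G : SimpleGraph V) [DecidableRel G.Adj] (z : V) : Matrix V V ℚ :=
  Matrix.of fun v => if v = z then Pi.single v 1 else
    ∑ w ∈ G.neighborFinset v, (Pi.single v 1 - Pi.single w 1)

/-- The matrix-tree theorem for parent maps. -/
theorem det_rootedLaplacian (G : SimpleGraph V) [DecidableRel G.Adj] (z : V) :
    (rootedLaplacian G z).det = Nat.card {f // IsParentMap G z f} := by
  classical
  set A : V → Finset V := fun v => if v = z then {z} else G.neighborFinset v with hA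
  have hrow : rootedLaplacian G z = fun v => ∑ w ∈ A v, parentRow z v w := by
    funext v
    change (if v = z then _ else _) = _
    by_cases hv : v = z
    · simp [hA, hv, parentRow]
    · simp only [hA, hv, parentRow, if_false]
  have hexp : (rootedLaplacian G z).det =
      ∑ f ∈ Fintype.piFinset A, (Matrix.of fun v => parentRow z v (f v)).det := by
    rw [hrow]
    exact (Matrix.detRowAlternating (n := V) (R := ℚ)).toMultilinearMap.map_sum_finset _ A
  have hmem : ∀ f, f ∈ Fintype.piFinset A ↔ f z = z ∧ ∀ v, v ≠ z → G.Adj v (f v) := by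
    intro f
    rw [Fintype.mem_piFinset]
    constructor
    · refine fun h => ⟨by simpa [hA] using h z, fun v hv => by simpa [hA, hv] using h v⟩
    · rintro ⟨h1, h2⟩ v
      by_cases hv : v = z
      · simp [hA, hv, h1]
      · simpa [hA, hv] using h2 v hv
  have hterm : ∀ f ∈ Fintype.piFinset A, (Matrix.of fun v => parentRow z v (f v)).det =
      if IsParentMap G z f then 1 else 0 := by
    intro f hf
    obtain ⟨h1, h2⟩ := (hmem f).1 hf
    by_cases hr : ∀ v, ∃ k, f^[k] v = z
    · rw [det_parentRow_of_reaches hr, if_pos ⟨h1, h2, hr⟩]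
    · rw [det_parentRow_of_not_reaches h1 hr, if_neg fun h => hr h.reaches]
  rw [hexp, Finset.sum_congr rfl hterm, Finset.sum_boole, Nat.card_eq_fintype_card,
    Fintype.card_subtype]
  congr 2
  ext f
  simp only [Finset.mem_filter, Finset.mem_univ, true_and, hmem]
  exact ⟨fun h => h.2, fun h => ⟨⟨h.map_root, h.adj⟩, h⟩⟩

end MatrixTree

/-! ### Evaluation of the determinant for the tripartite graph -/

section Tripartite

open Matrix

/-- The incidence matrix of the three parts, with the row of `z` cleared. -/
def partIncidence (m n p : ℕ) (z : TripartiteVertex m n p) :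
    Matrix (TripartiteVertex m n p) (Fin 3) ℚ :=
  Matrix.of fun v i => if v ≠ z ∧ v.1 ≠ i then 1 else 0

/-- The common degree of the vertices of a part. -/
def partDegree (m n p : ℕ) : Fin 3 → ℚ := ![n + p, m + p, m + n]

theorem card_neighborFinset_tripartite (m n p : ℕ) (v : TripartiteVertex m n p)
    [DecidableRel (completeTripartiteGraph m n p).Adj] :
    (((completeTripartiteGraph m n p).neighborFinset v).card : ℚ) = partDegree m n p v.1 := by
  classical
  rw [SimpleGraph.neighborFinset_eq_filter, Finset.card_filter]
  push_cast
  rw [Fintype.sum_sigma, Fin.sum_univ_three]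
  obtain ⟨i, x⟩ := v
  fin_cases i <;> simp [partDegree] <;>
    congr 1 <;> norm_cast <;> exact Fintype.card_fin _

/-- The matrix of the partition of the vertices into the three parts. -/
def partIndicator (m n p : ℕ) : Matrix (Fin 3) (TripartiteVertex m n p) ℚ :=
  Matrix.of fun i v => if v.1 = i then 1 else 0

/-- Adjacency depends only on the parts, so the adjacency matrix with row `z` cleared factors
through `Fin 3`. -/
theorem rootedLaplacian_tripartite (m n p : ℕ) (z : TripartiteVertex m n p)
    [DecidableRel (completeTripartiteGraph m n p).Adj] :
    rootedLaplacian (completeTripartiteGraph m n p) z =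
      Matrix.diagonal (fun v => if v = z then 1 else partDegree m n p v.1) -
        partIncidence m n p z * partIndicator m n p := by
  ext v w
  have hmul : (partIncidence m n p z * partIndicator m n p) v w =
      if v ≠ z ∧ v.1 ≠ w.1 then 1 else 0 := by
    simp [Matrix.mul_apply, partIncidence, partIndicator]
  rw [Matrix.sub_apply, hmul]
  by_cases hv : v = z
  · simp [rootedLaplacian, hv, Matrix.diagonal_apply, Pi.single_apply, eq_comm]
  · simp only [rootedLaplacian, Matrix.of_apply, if_neg hv, Finset.sum_sub_distrib, Pi.sub_apply,
      Finset.sum_apply, Finset.sum_const, nsmul_eq_mul, Pi.mul_apply, Pi.natCast_apply,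
      card_neighborFinset_tripartite, Matrix.diagonal_apply, Pi.single_apply]
    simp [hv, eq_comm]

/-- The extra factor restores the degree of `z`, which the unit row replaced by 1. -/
theorem prod_partDegree_mul (m n p : ℕ) (z : TripartiteVertex m n p) :
    (∏ v : TripartiteVertex m n p, if v = z then 1 else partDegree m n p v.1) *
      partDegree m n p z.1 = (n + p : ℚ) ^ m * (m + p) ^ n * (m + n) ^ p := by
  have hprod : ∏ v : TripartiteVertex m n p, partDegree m n p v.1 =
      (n + p : ℚ) ^ m * (m + p) ^ n * (m + n) ^ p := by
    rw [Fintype.prod_sigma, Fin.prod_univ_three]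
    simp only [Finset.prod_const, Finset.card_univ, Fintype.card_fin]
    rfl
  rw [← hprod, ← Finset.prod_erase_mul _ _ (Finset.mem_univ z),
    ← Finset.prod_erase_mul (f := fun v => partDegree m n p v.1) _ (Finset.mem_univ z),
    if_pos rfl, mul_one]
  congr 1
  exact Finset.prod_congr rfl fun v hv => if_neg (Finset.ne_of_mem_erase hv)

/-- The number of vertices other than `z` in a part. -/
theorem sum_part_ne (m n p : ℕ) (z : TripartiteVertex m n p) (i : Fin 3) :
    (∑ v : TripartiteVertex m n p, if v.1 = i ∧ v ≠ z then (1 : ℚ) else 0) =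
      (![m, n, p] i : ℕ) - if z.1 = i then 1 else 0 := by
  have h1 : ∀ v : TripartiteVertex m n p, (if v.1 = i ∧ v ≠ z then (1 : ℚ) else 0) =
      (if v.1 = i then 1 else 0) - if v = z then (if z.1 = i then 1 else 0) else 0 := by
    intro v
    by_cases hv : v = z
    · simp [hv]
    · simp [hv]
  simp_rw [h1]
  rw [Finset.sum_sub_distrib, Finset.sum_ite_eq' Finset.univ z, if_pos (Finset.mem_univ z),
    Fintype.sum_sigma, Fintype.sum_eq_single i fun j hj => by simp [hj]]
  simp

theorem det_rootedLaplacian_tripartite (m n p : ℕ) (z : TripartiteVertex m n p)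
    (hm : 1 ≤ m) (hn : 1 ≤ n) (hp : 1 ≤ p) (hz : z.1 = 2)
    [DecidableRel (completeTripartiteGraph m n p).Adj] :
    (rootedLaplacian (completeTripartiteGraph m n p) z).det =
      (m + n : ℚ) ^ (p - 1) * (m + p) ^ (n - 1) * (n + p) ^ (m - 1) * (m + n + p) := by
  have hm' : (0 : ℚ) < m := by exact_mod_cast hm
  have hn' : (0 : ℚ) < n := by exact_mod_cast hn
  have hp' : (0 : ℚ) < p := by exact_mod_cast hp
  have hdeg : ∀ i, partDegree m n p i ≠ 0 := by
    intro i
    fin_cases i <;> simp [partDegree] <;> positivity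
  set d : TripartiteVertex m n p → ℚ := fun v => if v = z then 1 else partDegree m n p v.1 with hd
  have hd0 : ∀ v, d v ≠ 0 := by
    intro v
    by_cases hv : v = z
    · simp [hd, hv]
    · simpa [hd, hv] using hdeg v.1
  have hfac : rootedLaplacian (completeTripartiteGraph m n p) z = Matrix.diagonal d *
      (1 - (Matrix.diagonal (fun v => (d v)⁻¹) * partIncidence m n p z) *
        partIndicator m n p) := by
    rw [rootedLaplacian_tripartite, mul_sub, mul_one, ← Matrix.mul_assoc, ← Matrix.mul_assoc,
      Matrix.diagonal_mul_diagonal]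
    simp_rw [mul_inv_cancel₀ (hd0 _), Matrix.diagonal_one, Matrix.one_mul]
    rfl
  -- Entry `(i, j)` with `i ≠ j` sums the inverse degrees over part `i` without `z`; only the third
  -- part loses a vertex.
  have hsmall : partIndicator m n p *
      (Matrix.diagonal (fun v => (d v)⁻¹) * partIncidence m n p z) =
      Matrix.of fun i j : Fin 3 => if i = j then 0 else
        ((![m, n, p] i : ℕ) - if (2 : Fin 3) = i then 1 else 0) / partDegree m n p i := by
    ext i j
    rw [Matrix.mul_apply, Matrix.of_apply]
    have hterm : ∀ v, partIndicator m n p i v *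
        (Matrix.diagonal (fun v => (d v)⁻¹) * partIncidence m n p z) v j =
        (if v.1 = i ∧ v ≠ z then (1 : ℚ) else 0) *
          if i = j then 0 else (partDegree m n p i)⁻¹ := by
      intro v
      rw [Matrix.diagonal_mul]
      by_cases hvi : v.1 = i
      · by_cases hv : v = z
        · simp [partIncidence, hv]
        · by_cases hij : i = j
          · simp [partIncidence, hvi, hij]
          · simp [partIncidence, partIndicator, hvi, hij, hv, hd]
      · simp [partIndicator, hvi]
    rw [Finset.sum_congr rfl fun v _ => hterm v, ← Finset.sum_mul, sum_part_ne, hz]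
    split_ifs <;> simp [div_eq_mul_inv]
  have hprod := prod_partDegree_mul m n p z
  rw [hz] at hprod
  rw [hfac, Matrix.det_mul, Matrix.det_diagonal, Matrix.det_one_sub_mul_comm, hsmall,
    eq_div_of_mul_eq (hdeg 2) hprod, Matrix.det_fin_three]
  -- Writing each size as a successor removes the truncated subtractions in the exponents.
  obtain ⟨a, rfl⟩ := Nat.exists_eq_add_of_le' hm
  obtain ⟨b, rfl⟩ := Nat.exists_eq_add_of_le' hn
  obtain ⟨c, rfl⟩ := Nat.exists_eq_add_of_le' hp
  simp [partDegree]
  field_simp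
  ring

end Tripartite

/-! ### Summation over the roots in the third part -/

theorem corollary2p2 (m n p : ℕ) (hm : 1 ≤ m) (hn : 1 ≤ n) (hp : 1 ≤ p) :
    Nat.card {R : RootedSpanningTree (completeTripartiteGraph m n p) //
        R.root ∈ thirdPart m n p} =
      p * (m + n) ^ (p - 1) * (m + p) ^ (n - 1) * (n + p) ^ (m - 1) * (m + n + p) := by
  classical
  have hroot : ∀ z : thirdPart m n p,
      Nat.card {R : RootedSpanningTree (completeTripartiteGraph m n p) // R.root = z} =
        (m + n) ^ (p - 1) * (m + p) ^ (n - 1) * (n + p) ^ (m - 1) * (m + n + p) := by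
    intro z
    rw [card_rootedSpanningTree_eq_card_isParentMap]
    have h := det_rootedLaplacian (completeTripartiteGraph m n p) z.1
    rw [det_rootedLaplacian_tripartite m n p z.1 hm hn hp z.2] at h
    exact_mod_cast h.symm
  have hcard : Nat.card (thirdPart m n p) = p := by
    have e : thirdPart m n p ≃ Fin p :=
      { toFun := fun v => Fin.cast (by rw [show v.1.1 = 2 from v.2]; rfl) v.1.2
        invFun := fun x => ⟨⟨2, x⟩, rfl⟩
        left_inv := by
          rintro ⟨⟨i, x⟩, hi⟩
          obtain rfl : i = 2 := hi
          rfl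
        right_inv := fun x => rfl }
    rw [Nat.card_congr e, Nat.card_fin]
  let e : {R : RootedSpanningTree (completeTripartiteGraph m n p) // R.root ∈ thirdPart m n p} ≃
      Σ z : thirdPart m n p,
        {R : RootedSpanningTree (completeTripartiteGraph m n p) // R.root = z} :=
    { toFun := fun R => ⟨⟨R.1.root, R.2⟩, ⟨R.1, rfl⟩⟩
      invFun := fun x => ⟨x.2.1, by rw [x.2.2]; exact x.1.2⟩
      left_inv := fun R => rfl
      right_inv := by
        rintro ⟨⟨z, hz⟩, ⟨R, hR : R.root = z⟩⟩
        cases hR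
        rfl }
  rw [Nat.card_congr e, Nat.card_sigma, Finset.sum_congr rfl fun z _ => hroot z,
    Finset.sum_const, Finset.card_univ, ← Nat.card_eq_fintype_card, hcard, smul_eq_mul]
  ring
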